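/- Let $\tau$ be a finite vocabulary consisting of predicate and constant symbols. All structures are finite, and all classes of structures are closed under isomorphism. For $k\in\mathbb{N}$ and a class $\mathcal{S}$ of finite $\tau$-structures: - $\mathcal{P}_{wqo}(\mathcal{S},k)$ holds if the class $\mathcal{S}_k$ of all expansions of structures of $\mathcal{S}$ by $k$ new constants is well-quasi-ordered under embeddability $\hookrightarrow$ (every infinite sequence $\mathfrak{A}_1,\mathfrak{A}_2,\dots$ from $\mathcal{S}_k$ has indices $i<j$ with $\mathfrak{A}_i\hookrightarrow\mathfrak{A}_j$). - $\mathcal{P}^{comp}_{logic}(\mathcal{S},k)$ holds, with witness function $f$, if $f:\mathbb{N}\to\mathbb{N}$ is computable and for every $m\in\mathbb{N}$, every $\mathfrak{A}\in\mathcal{S}$ and every set $W$ of at most $k$ elements of $\mathfrak{A}$, there is a substructure $\mathfrak{B}\subseteq\mathfrak{A}$ with $\mathfrak{B}\in\mathcal{S}$, $W\subseteq\mathsf{U}_{\mathfrak{B}}$, $|\mathfrak{B}|\le f(m)$ and $\mathfrak{B}\equiv_m\mathfrak{A}$ (that is, $\mathfrak{A}$ and $\mathfrak{B}$ satisfy the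 same first-order sentences of quantifier rank at most $m$). Operations on $\tau$-structures: - The complement $!\mathfrak{A}$ has the universe and constants of $\mathfrak{A}$, and $!\mathfrak{A}\models R(\bar a)$ iff $\mathfrak{A}\not\models R(\bar a)$, for every predicate $R$. - If $\tau$ has no constant symbols, the disjoint union $\mathfrak{A}\sqcup\mathfrak{B}$ has as universe the disjoint union of the two universes, and $R(\bar c)$ holds iff $\bar c$ lies in $\mathfrak{A}$ and $\mathfrak{A}\models R(\bar c)$, or $\bar c$ lies in $\mathfrak{B}$ and $\mathfrak{B}\models R(\bar c)$. - The cartesian product $\mathfrak{A}\times\mathfrak{B}$ and the tensor product $\mathfrak{A}\otimes\mathfrak{B}$ have universe $\mathsf{U}_{\mathfrak{A}}\times\mathsf{U}_{\mathfrak{B}}$, with constants interpreted componentwise. In $\mathfrak{A}\times\mathfrak{B}$, $R((a_1,b_1),\dots,(a_r,b_r))$ holds iff $(a_1=\dots=a_r$ and $\mathfrak{B}\models R(b_1,\dots,b_r))$ or $(\mathfrak{A}\models R(a_1,\dots,a_r)$ and $b_1=\dots=b_r)$. In $\mathfrak{A}\otimes\mathfrak{B}$ it holds iff $\mathfrak{A}\models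 R(a_1,\dots,a_r)$ and $\mathfrak{B}\models R(b_1,\dots,b_r)$. For classes, $!\mathcal{S}_1$ is the class of all structures isomorphic to $!\mathfrak{A}$ with $\mathfrak{A}\in\mathcal{S}_1$, and $\mathcal{S}_1\circledast\mathcal{S}_2$ is the class of all structures isomorphic to $\mathfrak{A}\circledast\mathfrak{B}$ with $\mathfrak{A}\in\mathcal{S}_1$, $\mathfrak{B}\in\mathcal{S}_2$, for $\circledast\in\{\sqcup,\times,\otimes\}$. **Lemma.** Let $k\in\mathbb{N}$ and let $\mathcal{S}_1,\mathcal{S}_2$ be classes of finite $\tau$-structures. Statements about $\sqcup$ are made when $\tau$ has no constant symbols. 1. If $\mathcal{P}_{wqo}(\mathcal{S}_1,k)$ holds, then $\mathcal{P}_{wqo}(!\mathcal{S}_1,k)$ holds. If $\mathcal{P}_{wqo}(\mathcal{S}_i,k)$ holds for $i=1,2$, then $\mathcal{P}_{wqo}(\mathcal{S}_1\circledast\mathcal{S}_2,k)$ holds for each $\circledast\in\{\sqcup,\times,\otimes\}$. 2. The same holds with $\mathcal{P}^{comp}_{logic}$ in place of $\mathcal{P}_{wqo}$. Moreover, if $\alpha_1$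 and $\alpha_2$ are computable witness functions of $\mathcal{P}^{comp}_{logic}(\mathcal{S}_1,k)$ and $\mathcal{P}^{comp}_{logic}(\mathcal{S}_2,k)$, then $\alpha_1$ is one of $\mathcal{P}^{comp}_{logic}(!\mathcal{S}_1,k)$, $\alpha_1+\alpha_2$ is one of $\mathcal{P}^{comp}_{logic}(\mathcal{S}_1\sqcup\mathcal{S}_2,k)$, and $\alpha_1\cdot\alpha_2$ is one of $\mathcal{P}^{comp}_{logic}(\mathcal{S}_1\times\mathcal{S}_2,k)$ and of $\mathcal{P}^{comp}_{logic}(\mathcal{S}_1\otimes\mathcal{S}_2,k)$. -/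

import Mathlib

open FirstOrder CategoryTheory

universe u v w

namespace StructClasses

/-- A vocabulary containing only finitely many symbols, all of which are predicate symbols or
constant symbols (no function symbols of positive arity). -/
structure IsFiniteRelational (L : FirstOrder.Language.{u, v}) : Prop where
  finite_symbols : Finite L.Symbols
  no_functions : ∀ n : ℕ, IsEmpty (L.Functions (n + 1))

/-- A class of finite `L`-structures that is closed under isomorphism. -/
structure StructClass (L : FirstOrder.Language.{u, v}) where
  carrier : Set (Bundled.{w} L.Structure)
  finite : ∀ M ∈ carrier, Finite M
  iso_closed : ∀ M ∈ carrier, ∀ N : Bundled.{w} L.Structure, Nonempty (M ≃[L] N) → N ∈ carrier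

instance (L : FirstOrder.Language.{u, v}) :
    Membership (Bundled.{w} L.Structure) (StructClass.{u, v, w} L) where
  mem S M := M ∈ S.carrier

section Properties

variable {L : FirstOrder.Language.{u, v}}

/-- `M` embeds in `N`, i.e. `M` is isomorphic to a substructure of `N`. -/
def Embeds (M N : Bundled.{w} L.Structure) : Prop := Nonempty (M ↪[L] N)

/-- The `L`-reduct of a structure over the vocabulary `L` with `k` new constants. -/
def reductOfConstants (k : ℕ) (M : Bundled.{w} (L[[Fin k]]).Structure) :
    Bundled.{w} L.Structure :=
  ⟨M, (L.lhomWithConstants (Fin k)).reduct M⟩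

/-- An isomorphism of structures over `L[[Fin k]]` is an isomorphism of the `L`-reducts. -/
def reductEquiv (k : ℕ) {M N : Bundled.{w} (L[[Fin k]]).Structure} (e : M ≃[L[[Fin k]]] N) :
    reductOfConstants k M ≃[L] reductOfConstants k N where
  toEquiv := e.toEquiv
  map_fun' f x := e.map_fun' ((L.lhomWithConstants (Fin k)).onFunction f) x
  map_rel' r x := e.map_rel' ((L.lhomWithConstants (Fin k)).onRelation r) x

/-- The class `S_k` of all structures over `L` with `k` new constants whose `L`-reduct is
in `S`. -/
def StructClass.withConstants (S : StructClass.{u, v, w} L) (k : ℕ) :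
    StructClass.{u, v, w} (L[[Fin k]]) where
  carrier := {M | reductOfConstants k M ∈ S}
  finite M hM := S.finite (reductOfConstants k M) hM
  iso_closed M hM N := fun ⟨e⟩ => S.iso_closed _ hM _ ⟨reductEquiv k e⟩

/-- `P_wqo(S, k)`: the class `S_k` is well-quasi-ordered under embeddability, that is, every
infinite sequence of members of `S_k` has a term that embeds in a later one. -/
def Pwqo (S : StructClass.{u, v, w} L) (k : ℕ) : Prop :=
  ∀ M : ℕ → Bundled.{w} (L[[Fin k]]).Structure, (∀ i, M i ∈ S.withConstants k) →
    ∃ i j, i < j ∧ Embeds (M i) (M j)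

/-- The quantifier rank of a first-order formula. -/
def quantifierRank {α : Type} : {n : ℕ} → L.BoundedFormula α n → ℕ
  | _, .falsum => 0
  | _, .equal _ _ => 0
  | _, .rel _ _ => 0
  | _, .imp φ ψ => max (quantifierRank φ) (quantifierRank ψ)
  | _, .all φ => quantifierRank φ + 1

/-- `M` and `N` agree on all first-order sentences of quantifier rank at most `m`. -/
def EquivUpTo (m : ℕ) (M N : Type w) [L.Structure M] [L.Structure N] : Prop :=
  ∀ φ : L.Sentence, quantifierRank φ ≤ m → (M ⊨ φ ↔ N ⊨ φ)

/-- `f` is a witness function of `P_logic(S, k)`. -/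
def IsPlogicWitness (S : StructClass.{u, v, w} L) (k : ℕ) (f : ℕ → ℕ) : Prop :=
  ∀ m : ℕ, ∀ A : Bundled.{w} L.Structure, A ∈ S → ∀ W : Finset A, W.card ≤ k →
    ∃ B : L.Substructure A,
      (Bundled.of B : Bundled.{w} L.Structure) ∈ S ∧
      (W : Set A) ⊆ B ∧
      Nat.card B ≤ f m ∧
      EquivUpTo (L := L) m B A

/-- `f` witnesses `P_logic^comp(S, k)`: it is a computable witness function of
`P_logic(S, k)`. -/
def IsPlogicCompWitness (S : StructClass.{u, v, w} L) (k : ℕ) (f : ℕ → ℕ) : Prop :=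
  Computable f ∧ IsPlogicWitness S k f

/-- `P_logic^comp(S, k)`. -/
def PlogicComp (S : StructClass.{u, v, w} L) (k : ℕ) : Prop :=
  ∃ f : ℕ → ℕ, IsPlogicCompWitness S k f

end Properties

section Operations

variable {L : FirstOrder.Language.{u, v}}

/-- The complement `!A`: the same universe and constants, every predicate is replaced by its
negation. -/
def complement (A : Bundled.{w} L.Structure) : Bundled.{w} L.Structure where
  α := A
  str :=
    { funMap := fun f x => A.str.funMap f x
      RelMap := fun R x => ¬ A.str.RelMap R x }

/-- The disjoint union of `A` and `B`, for a vocabulary of predicate symbols only: a predicate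
holds of a tuple iff the tuple lies entirely in `A` and the predicate holds of it there, or it
lies entirely in `B` and the predicate holds of it there. -/
def disjointUnion [L.IsRelational] (A B : Bundled.{w} L.Structure) : Bundled.{w} L.Structure where
  α := A ⊕ B
  str :=
    { funMap := fun f => isEmptyElim f
      RelMap := fun R x =>
        (∃ a, x = Sum.inl ∘ a ∧ A.str.RelMap R a) ∨ (∃ b, x = Sum.inr ∘ b ∧ B.str.RelMap R b) }

/-- The cartesian product of `A` and `B`; constants are interpreted componentwise. -/
def cartesianProduct (A B : Bundled.{w} L.Structure) : Bundled.{w} L.Structure where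
  α := A × B
  str :=
    { funMap := fun f x => (A.str.funMap f (Prod.fst ∘ x), B.str.funMap f (Prod.snd ∘ x))
      RelMap := fun R x =>
        ((∀ i j, (x i).1 = (x j).1) ∧ B.str.RelMap R (Prod.snd ∘ x)) ∨
        (A.str.RelMap R (Prod.fst ∘ x) ∧ (∀ i j, (x i).2 = (x j).2)) }

/-- The tensor product of `A` and `B`; constants are interpreted componentwise. -/
def tensorProduct (A B : Bundled.{w} L.Structure) : Bundled.{w} L.Structure where
  α := A × B
  str :=
    { funMap := fun f x => (A.str.funMap f (Prod.fst ∘ x), B.str.funMap f (Prod.snd ∘ x))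
      RelMap := fun R x => A.str.RelMap R (Prod.fst ∘ x) ∧ B.str.RelMap R (Prod.snd ∘ x) }

/-- The class of all structures isomorphic to `op A` for some `A` in `S`. -/
def StructClass.unary (op : Bundled.{w} L.Structure → Bundled.{w} L.Structure)
    (hop : ∀ A : Bundled.{w} L.Structure, Finite A → Finite (op A)) (S : StructClass.{u, v, w} L) :
    StructClass.{u, v, w} L where
  carrier := {C | ∃ A ∈ S, Nonempty (op A ≃[L] C)}
  finite := fun _ ⟨A, hA, ⟨e⟩⟩ =>
    have := hop A (S.finite A hA)
    Finite.of_equiv _ e.toEquiv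
  iso_closed := fun _ ⟨A, hA, ⟨e⟩⟩ _ ⟨e'⟩ => ⟨A, hA, ⟨e'.comp e⟩⟩

/-- The class of all structures isomorphic to `op A B` for some `A` in `S₁` and `B` in `S₂`. -/
def StructClass.binary
    (op : Bundled.{w} L.Structure → Bundled.{w} L.Structure → Bundled.{w} L.Structure)
    (hop : ∀ A B : Bundled.{w} L.Structure, Finite A → Finite B → Finite (op A B)) (S₁ S₂ : StructClass.{u, v, w} L) :
    StructClass.{u, v, w} L where
  carrier := {C | ∃ A ∈ S₁, ∃ B ∈ S₂, Nonempty (op A B ≃[L] C)}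
  finite := fun _ ⟨A, hA, B, hB, ⟨e⟩⟩ =>
    have := hop A B (S₁.finite A hA) (S₂.finite B hB)
    Finite.of_equiv _ e.toEquiv
  iso_closed := fun _ ⟨A, hA, B, hB, ⟨e⟩⟩ _ ⟨e'⟩ => ⟨A, hA, B, hB, ⟨e'.comp e⟩⟩

/-- The class `!S`. -/
def StructClass.compl (S : StructClass.{u, v, w} L) : StructClass.{u, v, w} L :=
  StructClass.unary complement (fun _ h => h) S

/-- The class `S₁ ⊔ S₂` of disjoint unions. -/
def StructClass.disjUnion [L.IsRelational] (S₁ S₂ : StructClass.{u, v, w} L) :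
    StructClass.{u, v, w} L :=
  StructClass.binary disjointUnion
    (fun A B (_ : Finite A) (_ : Finite B) => inferInstanceAs (Finite (A ⊕ B))) S₁ S₂

/-- The class `S₁ × S₂` of cartesian products. -/
def StructClass.cartesian (S₁ S₂ : StructClass.{u, v, w} L) : StructClass.{u, v, w} L :=
  StructClass.binary cartesianProduct
    (fun A B (_ : Finite A) (_ : Finite B) => inferInstanceAs (Finite (A × B))) S₁ S₂

/-- The class `S₁ ⊗ S₂` of tensor products. -/
def StructClass.tensor (S₁ S₂ : StructClass.{u, v, w} L) : StructClass.{u, v, w} L :=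
  StructClass.binary tensorProduct
    (fun A B (_ : Finite A) (_ : Finite B) => inferInstanceAs (Finite (A × B))) S₁ S₂

end Operations

end StructClasses

/-!
Everything rests on two properties of the operations: they are functorial on embeddings, and
equivalence up to quantifier rank `m` is a congruence for them.

An element of `A × B`, `A ⊗ B` or `A ⊔ B` is determined by its components in `A` and in `B`, one of
which is missing in the case of `A ⊔ B`, and embeddings of `A` and `B` induce an embedding of the
compound structure that acts on components. `ComponentOp` collects these facts, and both properties
of classes are transferred for all such operations at once.

For `P_wqo`, the `k` constants of an expansion of the compound structure are replaced by their
components, which gives a partial `k`-tuple in each argument. The class of structures of `S` with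
partial `k`-tuples is well-quasi-ordered (`Pwqo.wellQuasiOrdered_pointedEmbeds`): by the pigeonhole
principle the domains may be assumed equal, and then the undefined entries are filled with arbitrary
elements. Only a sequence of empty structures does not permit this, and there the finiteness of the
vocabulary is used: empty structures differ only in the truth of the predicates of arity `0`. The
product of two well-quasi-orders is one, which yields `Pwqo.binary`.

For `P_logic`, the at most `k` given elements have at most `k` components in each argument, and the
compound of the two substructures obtained for these components is the required substructure, up to
isomorphism (`IsPlogicWitness.binary`). That it is equivalent up to rank `m` is shown by
Ehrenfeucht–Fraïssé games played in the two arguments separately (`equivUpTo_booleanProduct`,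
`equivUpTo_disjointUnion`). Since all structures are finite, the back-and-forth property
(`TupleEquiv.forth`) needs only finite conjunctions over the elements of a structure.
-/

namespace StructClasses

open FirstOrder.Language

/-! ### Equivalence up to quantifier rank and back-and-forth -/

section QuantifierRank

variable {L : FirstOrder.Language.{u, v}}

/-- The tuples `xs` of `M` and `ys` of `N` satisfy the same formulas of quantifier rank at
most `m`. -/
def TupleEquiv (m : ℕ) {M N : Type w} [L.Structure M] [L.Structure N] {n : ℕ}
    (xs : Fin n → M) (ys : Fin n → N) : Prop :=
  ∀ φ : L.BoundedFormula Empty n, quantifierRank φ ≤ m →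
    (φ.Realize default xs ↔ φ.Realize default ys)

section

variable {M N : Type w} [L.Structure M] [L.Structure N] {m n : ℕ} {xs : Fin n → M}
  {ys : Fin n → N}

theorem equivUpTo_iff_tupleEquiv :
    EquivUpTo (L := L) m M N ↔
      TupleEquiv (L := L) m (default : Fin 0 → M) (default : Fin 0 → N) :=
  Iff.rfl

theorem TupleEquiv.symm (h : TupleEquiv (L := L) m xs ys) : TupleEquiv (L := L) m ys xs :=
  fun φ hφ => (h φ hφ).symm

theorem TupleEquiv.congr (h : TupleEquiv (L := L) m xs ys) {xs' : Fin n → M} {ys' : Fin n → N}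
    (hx : xs' = xs) (hy : ys' = ys) : TupleEquiv (L := L) m xs' ys' :=
  hx ▸ hy ▸ h

theorem TupleEquiv.mono {m' : ℕ} (h : TupleEquiv (L := L) m xs ys) (hm : m' ≤ m) :
    TupleEquiv (L := L) m' xs ys :=
  fun φ hφ => h φ (hφ.trans hm)

theorem TupleEquiv.equal_iff (h : TupleEquiv (L := L) m xs ys) (t t' : L.Term (Empty ⊕ Fin n)) :
    t.realize (Sum.elim default xs) = t'.realize (Sum.elim default xs) ↔
      t.realize (Sum.elim default ys) = t'.realize (Sum.elim default ys) :=
  h (.equal t t') (Nat.zero_le _)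

theorem TupleEquiv.rel_iff (h : TupleEquiv (L := L) m xs ys) {l : ℕ} (R : L.Relations l)
    (ts : Fin l → L.Term (Empty ⊕ Fin n)) :
    Structure.RelMap R (fun i => (ts i).realize (Sum.elim default xs)) ↔
      Structure.RelMap R (fun i => (ts i).realize (Sum.elim default ys)) :=
  h (.rel R ts) (Nat.zero_le _)

/-- The forth property of the Ehrenfeucht–Fraïssé game. As `N` is finite, an element without a
partner would be separated from all elements of `N` by a single conjunction, so the vocabulary
need not be finite here. -/
theorem TupleEquiv.forth [Finite N] (h : TupleEquiv (L := L) (m + 1) xs ys) (a : M) :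
    ∃ b : N, TupleEquiv (L := L) m (Fin.snoc xs a : Fin (n + 1) → M) (Fin.snoc ys b) := by
  classical
  by_contra! hcon
  have hsep : ∀ b : N, ∃ φ : L.BoundedFormula Empty (n + 1), quantifierRank φ ≤ m ∧
      φ.Realize default (Fin.snoc xs a) ∧ ¬ φ.Realize default (Fin.snoc ys b) := by
    intro b
    have hb := hcon b
    simp only [TupleEquiv, not_forall] at hb
    obtain ⟨φ, hφ, hne⟩ := hb
    by_cases ha : φ.Realize default (Fin.snoc xs a : Fin (n + 1) → M)
    · exact ⟨φ, hφ, ha, fun hb => hne (iff_of_true ha hb)⟩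
    · refine ⟨φ.imp .falsum, by simpa [quantifierRank] using hφ, fun h => (ha h).elim, ?_⟩
      intro hb
      exact hne (iff_of_false ha hb)
  have hall : ∀ s : Finset N, ∃ φ : L.BoundedFormula Empty (n + 1), quantifierRank φ ≤ m ∧
      φ.Realize default (Fin.snoc xs a) ∧ ∀ b ∈ s, ¬ φ.Realize default (Fin.snoc ys b) := by
    intro s
    induction s using Finset.induction_on with
    | empty => exact ⟨.imp .falsum .falsum, by simp [quantifierRank], fun h => h, by simp⟩
    | insert b s _ ih =>
      obtain ⟨φ, hφ, ha, hs⟩ := ih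
      obtain ⟨ψ, hψ, ha', hb⟩ := hsep b
      refine ⟨(φ.imp (ψ.imp .falsum)).imp .falsum, by simp [quantifierRank, hφ, hψ],
        fun h => h ha ha', ?_⟩
      intro b' hb' hr
      refine hr fun hφb hψb => ?_
      rcases Finset.mem_insert.1 hb' with rfl | hb'
      · exact hb hψb
      · exact hs b' hb' hφb
  have := Fintype.ofFinite N
  obtain ⟨φ, hφ, ha, hN⟩ := hall Finset.univ
  have := (h (.all (φ.imp .falsum)) (by simp [quantifierRank, hφ])).2
    (fun b hb => hN b (Finset.mem_univ b) hb)
  exact this a ha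

theorem TupleEquiv.back [Finite M] (h : TupleEquiv (L := L) (m + 1) xs ys) (b : N) :
    ∃ a : M, TupleEquiv (L := L) m (Fin.snoc xs a : Fin (n + 1) → M) (Fin.snoc ys b) := by
  obtain ⟨a, ha⟩ := h.symm.forth b
  exact ⟨a, ha.symm⟩

end

/-- Soundness of the Ehrenfeucht–Fraïssé game: a family `I m` of relations between tuples that
respects atomic formulas and has the back-and-forth property refines equivalence up to quantifier
rank `m`. -/
theorem tupleEquiv_of_backAndForth {M N : Type w} [L.Structure M] [L.Structure N]
    (I : ℕ → ∀ {n : ℕ}, (Fin n → M) → (Fin n → N) → Prop)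
    (equal : ∀ {m n : ℕ} {xs : Fin n → M} {ys : Fin n → N}, I m xs ys →
      ∀ t t' : L.Term (Empty ⊕ Fin n),
        t.realize (Sum.elim default xs) = t'.realize (Sum.elim default xs) ↔
          t.realize (Sum.elim default ys) = t'.realize (Sum.elim default ys))
    (rel : ∀ {m n : ℕ} {xs : Fin n → M} {ys : Fin n → N}, I m xs ys →
      ∀ {l : ℕ} (R : L.Relations l) (ts : Fin l → L.Term (Empty ⊕ Fin n)),
        Structure.RelMap R (fun i => (ts i).realize (Sum.elim default xs)) ↔
          Structure.RelMap R (fun i => (ts i).realize (Sum.elim default ys)))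
    (forth : ∀ {m n : ℕ} {xs : Fin n → M} {ys : Fin n → N}, I (m + 1) xs ys →
      ∀ a : M, ∃ b : N, I m (Fin.snoc xs a : Fin (n + 1) → M) (Fin.snoc ys b))
    (back : ∀ {m n : ℕ} {xs : Fin n → M} {ys : Fin n → N}, I (m + 1) xs ys →
      ∀ b : N, ∃ a : M, I m (Fin.snoc xs a : Fin (n + 1) → M) (Fin.snoc ys b))
    {m n : ℕ} {xs : Fin n → M} {ys : Fin n → N} (h : I m xs ys) :
    TupleEquiv (L := L) m xs ys := by
  intro φ hφ
  induction φ generalizing m with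
  | falsum => exact Iff.rfl
  | equal t t' => exact equal h t t'
  | rel R ts => exact rel h R ts
  | imp φ ψ ihφ ihψ =>
    have hr : max (quantifierRank φ) (quantifierRank ψ) ≤ m := hφ
    exact imp_congr (ihφ h (le_of_max_le_left hr)) (ihψ h (le_of_max_le_right hr))
  | all φ ih =>
    have hr : quantifierRank φ + 1 ≤ m := hφ
    obtain ⟨m, rfl⟩ : ∃ m', m = m' + 1 := ⟨m - 1, by omega⟩
    have hr : quantifierRank φ ≤ m := by omega
    constructor
    · intro hx b
      obtain ⟨a, ha⟩ := back h b
      exact (ih ha hr).1 (hx a)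
    · intro hy a
      obtain ⟨b, hb⟩ := forth h a
      exact (ih hb hr).2 (hy b)

end QuantifierRank

/-! ### The operations preserve equivalence up to quantifier rank -/

section Operations

variable {L : FirstOrder.Language.{u, v}}

/-- A rule for the truth of an `n`-ary predicate at a tuple of pairs. It depends on the equality
type of the tuple of first components, on the truth of the predicate at this tuple, and on the same
two data for the second components. -/
abbrev ProductRule :=
  ∀ n : ℕ, (Fin n → Fin n → Prop) → Prop → (Fin n → Fin n → Prop) → Prop → Prop

/-- The product of `A` and `B` in which the function symbols act componentwise and the predicates
are given by the rule `F`. -/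
def booleanProduct (F : ProductRule) (A B : Bundled.{w} L.Structure) :
    Bundled.{w} L.Structure where
  α := A × B
  str :=
    { funMap := fun f x => (A.str.funMap f (Prod.fst ∘ x), B.str.funMap f (Prod.snd ∘ x))
      RelMap := fun {n} R x => F n (fun i j => (x i).1 = (x j).1) (A.str.RelMap R (Prod.fst ∘ x))
        (fun i j => (x i).2 = (x j).2) (B.str.RelMap R (Prod.snd ∘ x)) }

/-- The rule of the cartesian product: `booleanProduct cartesianRule` and `cartesianProduct` are
equal by definition. -/
def cartesianRule : ProductRule :=
  fun _ E p E' q => ((∀ i j, E i j) ∧ q) ∨ (p ∧ ∀ i j, E' i j)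

/-- The rule of the tensor product: `booleanProduct tensorRule` and `tensorProduct` are equal by
definition. -/
def tensorRule : ProductRule :=
  fun _ _ p _ q => p ∧ q

section

variable (F : ProductRule)

theorem realize_booleanProduct {A B : Bundled.{w} L.Structure} {α : Type}
    (t : L.Term α) (x : α → booleanProduct F A B) :
    t.realize x = (t.realize (fun i => (x i).1), t.realize (fun i => (x i).2)) := by
  induction t with
  | var => rfl
  | func f ts ih =>
    simp only [Term.realize, ih]
    rfl

/-- Equivalence up to quantifier rank `m` is a congruence for products: partners are chosen
componentwise. -/
theorem equivUpTo_booleanProduct {A A' B B' : Bundled.{w} L.Structure} [Finite A] [Finite A']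
    [Finite B] [Finite B'] {m : ℕ} (hA : EquivUpTo (L := L) m A A')
    (hB : EquivUpTo (L := L) m B B') :
    EquivUpTo (L := L) m (booleanProduct F A B) (booleanProduct F A' B') := by
  have hreal : ∀ {A B : Bundled.{w} L.Structure} {n : ℕ} (xs : Fin n → booleanProduct F A B)
      (t : L.Term (Empty ⊕ Fin n)), t.realize (Sum.elim default xs) =
        (t.realize (Sum.elim default fun i => (xs i).1),
          t.realize (Sum.elim default fun i => (xs i).2)) := by
    intro A B n xs t
    rw [realize_booleanProduct]
    congr 2 <;> (funext i; rcases i with i | i; exacts [i.elim, rfl])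
  have hsnoc : ∀ {X Y : Type w} {n : ℕ} (xs : Fin n → X × Y) (x : X × Y),
      (fun i => ((Fin.snoc xs x : Fin (n + 1) → X × Y) i).1) =
        (Fin.snoc (fun i => (xs i).1) x.1 : Fin (n + 1) → X) ∧
      (fun i => ((Fin.snoc xs x : Fin (n + 1) → X × Y) i).2) =
        (Fin.snoc (fun i => (xs i).2) x.2 : Fin (n + 1) → Y) := by
    intro X Y n xs x
    constructor <;> (funext i; refine Fin.lastCases ?_ (fun i => ?_) i <;> simp)
  refine equivUpTo_iff_tupleEquiv.2 (tupleEquiv_of_backAndForth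
    (M := booleanProduct F A B) (N := booleanProduct F A' B')
    (fun m n xs ys =>
      TupleEquiv (L := L) m (fun i => (xs i).1) (fun i => (ys i).1) ∧
      TupleEquiv (L := L) m (fun i => (xs i).2) (fun i => (ys i).2))
    ?_ ?_ ?_ ?_ ?_)
  · rintro m n xs ys ⟨h1, h2⟩ t t'
    rw [hreal, hreal, hreal, hreal]
    refine Prod.mk_inj.trans (Iff.trans ?_ Prod.mk_inj.symm)
    exact and_congr (h1.equal_iff t t') (h2.equal_iff t t')
  · rintro m n xs ys ⟨h1, h2⟩ l R ts
    simp only [hreal]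
    refine iff_of_eq ?_
    change F l _ _ _ _ = F l _ _ _ _
    congr 1
    · funext i j; exact propext (h1.equal_iff (ts i) (ts j))
    · exact propext (h1.rel_iff R ts)
    · funext i j; exact propext (h2.equal_iff (ts i) (ts j))
    · exact propext (h2.rel_iff R ts)
  · rintro m n xs ys ⟨h1, h2⟩ ⟨a, b⟩
    obtain ⟨a', ha⟩ := h1.forth a
    obtain ⟨b', hb⟩ := h2.forth b
    refine ⟨(a', b'), ?_, ?_⟩
    · exact ha.congr (hsnoc xs (a, b)).1 (hsnoc ys (a', b')).1
    · exact hb.congr (hsnoc xs (a, b)).2 (hsnoc ys (a', b')).2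
  · rintro m n xs ys ⟨h1, h2⟩ ⟨a', b'⟩
    obtain ⟨a, ha⟩ := h1.back a'
    obtain ⟨b, hb⟩ := h2.back b'
    refine ⟨(a, b), ?_, ?_⟩
    · exact ha.congr (hsnoc xs (a, b)).1 (hsnoc ys (a', b')).1
    · exact hb.congr (hsnoc xs (a, b)).2 (hsnoc ys (a', b')).2
  · constructor
    · convert equivUpTo_iff_tupleEquiv.1 hA
    · convert equivUpTo_iff_tupleEquiv.1 hB

end

theorem realize_complement {A : Bundled.{w} L.Structure} {α : Type} (t : L.Term α)
    (x : α → A) :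
    @Term.realize L (complement A) (complement A).str α x t = @Term.realize L A A.str α x t := by
  induction t with
  | var => rfl
  | func f ts ih => exact congrArg (A.str.funMap f) (funext ih)

theorem equivUpTo_complement {A A' : Bundled.{w} L.Structure} [Finite A] [Finite A'] {m : ℕ}
    (h : EquivUpTo (L := L) m A A') :
    EquivUpTo (L := L) m (complement A) (complement A') := by
  have hreal : ∀ {A : Bundled.{w} L.Structure} {n : ℕ} (xs : Fin n → A)
      (t : L.Term (Empty ⊕ Fin n)),
      @Term.realize L (complement A) (complement A).str _
        (Sum.elim (default : Empty → complement A) xs) t =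
      @Term.realize L A A.str _ (Sum.elim default xs) t := by
    intro A n xs t
    refine (realize_complement t _).trans (congrArg (fun x => @Term.realize L A A.str _ x t) ?_)
    funext i
    rcases i with i | i
    exacts [i.elim, rfl]
  refine equivUpTo_iff_tupleEquiv.2 (tupleEquiv_of_backAndForth
    (M := complement A) (N := complement A')
    (fun m n xs ys => TupleEquiv (L := L) (M := A) (N := A') m xs ys) ?_ ?_ ?_ ?_ ?_)
  · intro m n xs ys h t t'
    exact (Eq.congr (hreal (A := A) xs t) (hreal (A := A) xs t')).trans
      ((h.equal_iff t t').trans (Eq.congr (hreal (A := A') ys t) (hreal (A := A') ys t')).symm)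
  · intro m n xs ys h l R ts
    have hx := congrArg (A.str.RelMap R) (funext fun i => hreal (A := A) xs (ts i))
    have hy := congrArg (A'.str.RelMap R) (funext fun i => hreal (A := A') ys (ts i))
    exact not_congr ((iff_of_eq hx).trans ((h.rel_iff R ts).trans (iff_of_eq hy).symm))
  · intro m n xs ys h a
    exact h.forth a
  · intro m n xs ys h b
    exact h.back b
  · exact (equivUpTo_iff_tupleEquiv.1 h).congr (Subsingleton.elim _ _) (Subsingleton.elim _ _)

/-- In a disjoint union the game is played in the two parts separately: a position is given by
a pair of tuples in the first parts and a pair of tuples in the second parts such that every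
matched pair of elements occurs, on the same side, in one of these. -/
theorem equivUpTo_disjointUnion [L.IsRelational] {A A' B B' : Bundled.{w} L.Structure} [Finite A]
    [Finite A'] [Finite B] [Finite B'] {m : ℕ} (hA : EquivUpTo (L := L) m A A')
    (hB : EquivUpTo (L := L) m B B') :
    EquivUpTo (L := L) m (disjointUnion A B) (disjointUnion A' B') := by
  let I : ℕ → ∀ {n : ℕ}, (Fin n → A ⊕ B) → (Fin n → A' ⊕ B') → Prop := fun m n xs ys =>
    ∃ (p q : ℕ) (a : Fin p → A) (a' : Fin p → A') (b : Fin q → B) (b' : Fin q → B'),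
      TupleEquiv (L := L) m a a' ∧ TupleEquiv (L := L) m b b' ∧
      ∀ i, (∃ j, xs i = Sum.inl (a j) ∧ ys i = Sum.inl (a' j)) ∨
        (∃ j, xs i = Sum.inr (b j) ∧ ys i = Sum.inr (b' j))
  -- There are no function symbols, so every term is a variable.
  have hterm : ∀ {n : ℕ} (t : L.Term (Empty ⊕ Fin n)), ∃ i, t = .var (Sum.inr i) := by
    intro n t
    cases t with
    | var i => rcases i with i | i; exacts [i.elim, ⟨i, rfl⟩]
    | func f ts => exact isEmptyElim f
  have heq : ∀ {X Y : Bundled.{w} L.Structure} {m p : ℕ} {a : Fin p → X} {a' : Fin p → Y},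
      TupleEquiv (L := L) m a a' → ∀ j j', a j = a j' ↔ a' j = a' j' :=
    fun h j j' => h.equal_iff (.var (Sum.inr j)) (.var (Sum.inr j'))
  have hrel : ∀ {X Y : Bundled.{w} L.Structure} {m p : ℕ} {a : Fin p → X} {a' : Fin p → Y},
      TupleEquiv (L := L) m a a' → ∀ {l : ℕ} (R : L.Relations l) (j : Fin l → Fin p),
        Structure.RelMap R (a ∘ j) ↔ Structure.RelMap R (a' ∘ j) :=
    fun h _ R j => h.rel_iff R (fun i => .var (Sum.inr (j i)))
  have hext : ∀ {m n p q : ℕ} {xs : Fin n → A ⊕ B} {ys : Fin n → A' ⊕ B'} {x : A ⊕ B}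
      {y : A' ⊕ B'} (a : Fin p → A) (a' : Fin p → A') (b : Fin q → B) (b' : Fin q → B'),
      TupleEquiv (L := L) m a a' → TupleEquiv (L := L) m b b' →
      (∀ i, (∃ j, xs i = Sum.inl (a j) ∧ ys i = Sum.inl (a' j)) ∨
        (∃ j, xs i = Sum.inr (b j) ∧ ys i = Sum.inr (b' j))) →
      ((∃ j, x = Sum.inl (a j) ∧ y = Sum.inl (a' j)) ∨
        (∃ j, x = Sum.inr (b j) ∧ y = Sum.inr (b' j))) →
      I m (Fin.snoc xs x : Fin (n + 1) → A ⊕ B) (Fin.snoc ys y) := by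
    intro m n p q xs ys x y a a' b b' h1 h2 h3 h4
    refine ⟨p, q, a, a', b, b', h1, h2, fun i => ?_⟩
    refine Fin.lastCases ?_ (fun i => ?_) i
    · simpa using h4
    · simpa using h3 i
  -- Lengthening a tuple in one part keeps the matched pairs.
  have hlift : ∀ {X Y X' Y' : Type w} {n p : ℕ} {xs : Fin n → X} {ys : Fin n → Y} (f : X' → X)
      (g : Y' → Y) (a : Fin p → X') (a' : Fin p → Y') (c : X') (c' : Y') (i : Fin n),
      (∃ j, xs i = f (a j) ∧ ys i = g (a' j)) →
      ∃ j, xs i = f ((Fin.snoc a c : Fin (p + 1) → X') j) ∧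
        ys i = g ((Fin.snoc a' c' : Fin (p + 1) → Y') j) := by
    rintro X Y X' Y' n p xs ys f g a a' c c' i ⟨j, h, h'⟩
    exact ⟨j.castSucc, by simpa using h, by simpa using h'⟩
  have key : TupleEquiv (L := L) (M := disjointUnion A B) (N := disjointUnion A' B') m
      (default : Fin 0 → disjointUnion A B) (default : Fin 0 → disjointUnion A' B') := by
    refine tupleEquiv_of_backAndForth (M := disjointUnion A B) (N := disjointUnion A' B') I
      ?_ ?_ ?_ ?_ ⟨0, 0, default, default, default, default, hA, hB, fun i => i.elim0⟩
    · rintro m n xs ys ⟨p, q, a, a', b, b', h1, h2, h⟩ t t'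
      obtain ⟨i, rfl⟩ := hterm t
      obtain ⟨i', rfl⟩ := hterm t'
      change xs i = xs i' ↔ ys i = ys i'
      rcases h i with ⟨j, e, f⟩ | ⟨j, e, f⟩ <;> rcases h i' with ⟨j', e', f'⟩ | ⟨j', e', f'⟩
      · rw [e, e', f, f']
        exact Sum.inl_injective.eq_iff.trans ((heq h1 j j').trans Sum.inl_injective.eq_iff.symm)
      · rw [e, e', f, f']; exact iff_of_false Sum.inl_ne_inr Sum.inl_ne_inr
      · rw [e, e', f, f']; exact iff_of_false Sum.inr_ne_inl Sum.inr_ne_inl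
      · rw [e, e', f, f']
        exact Sum.inr_injective.eq_iff.trans ((heq h2 j j').trans Sum.inr_injective.eq_iff.symm)
    · rintro m n xs ys ⟨p, q, a, a', b, b', h1, h2, h⟩ l R ts
      choose i hi using fun s => hterm (ts s)
      obtain rfl : ts = fun s => .var (Sum.inr (i s)) := funext hi
      refine or_congr ?_ ?_
      · constructor
        · rintro ⟨c, hc, hR⟩
          have hj : ∀ s, ∃ j, xs (i s) = Sum.inl (a j) ∧ ys (i s) = Sum.inl (a' j) := by
            intro s
            refine (h (i s)).resolve_right ?_
            rintro ⟨j, e, -⟩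
            exact Sum.inl_ne_inr ((congrFun hc s).symm.trans e)
          choose j hj hj' using hj
          obtain rfl : c = a ∘ j :=
            funext fun s => Sum.inl_injective ((congrFun hc s).symm.trans (hj s))
          exact ⟨a' ∘ j, funext hj', (hrel h1 R j).1 hR⟩
        · rintro ⟨c, hc, hR⟩
          have hj : ∀ s, ∃ j, xs (i s) = Sum.inl (a j) ∧ ys (i s) = Sum.inl (a' j) := by
            intro s
            refine (h (i s)).resolve_right ?_
            rintro ⟨j, -, e⟩
            exact Sum.inl_ne_inr ((congrFun hc s).symm.trans e)
          choose j hj hj' using hj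
          obtain rfl : c = a' ∘ j :=
            funext fun s => Sum.inl_injective ((congrFun hc s).symm.trans (hj' s))
          exact ⟨a ∘ j, funext hj, (hrel h1 R j).2 hR⟩
      · constructor
        · rintro ⟨c, hc, hR⟩
          have hj : ∀ s, ∃ j, xs (i s) = Sum.inr (b j) ∧ ys (i s) = Sum.inr (b' j) := by
            intro s
            refine (h (i s)).resolve_left ?_
            rintro ⟨j, e, -⟩
            exact Sum.inr_ne_inl ((congrFun hc s).symm.trans e)
          choose j hj hj' using hj
          obtain rfl : c = b ∘ j :=
            funext fun s => Sum.inr_injective ((congrFun hc s).symm.trans (hj s))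
          exact ⟨b' ∘ j, funext hj', (hrel h2 R j).1 hR⟩
        · rintro ⟨c, hc, hR⟩
          have hj : ∀ s, ∃ j, xs (i s) = Sum.inr (b j) ∧ ys (i s) = Sum.inr (b' j) := by
            intro s
            refine (h (i s)).resolve_left ?_
            rintro ⟨j, -, e⟩
            exact Sum.inr_ne_inl ((congrFun hc s).symm.trans e)
          choose j hj hj' using hj
          obtain rfl : c = b' ∘ j :=
            funext fun s => Sum.inr_injective ((congrFun hc s).symm.trans (hj' s))
          exact ⟨b ∘ j, funext hj, (hrel h2 R j).2 hR⟩
    · rintro m n xs ys ⟨p, q, a, a', b, b', h1, h2, h⟩ (c | c)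
      · obtain ⟨c', hc⟩ := h1.forth c
        exact ⟨Sum.inl c', hext _ _ b b' hc (h2.mono m.le_succ)
          (fun i => (h i).imp_left (hlift Sum.inl Sum.inl a a' c c' i))
          (.inl ⟨Fin.last p, by simp, by simp⟩)⟩
      · obtain ⟨c', hc⟩ := h2.forth c
        exact ⟨Sum.inr c', hext a a' _ _ (h1.mono m.le_succ) hc
          (fun i => (h i).imp_right (hlift Sum.inr Sum.inr b b' c c' i))
          (.inr ⟨Fin.last q, by simp, by simp⟩)⟩
    · rintro m n xs ys ⟨p, q, a, a', b, b', h1, h2, h⟩ (c' | c')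
      · obtain ⟨c, hc⟩ := h1.back c'
        exact ⟨Sum.inl c, hext _ _ b b' hc (h2.mono m.le_succ)
          (fun i => (h i).imp_left (hlift Sum.inl Sum.inl a a' c c' i))
          (.inl ⟨Fin.last p, by simp, by simp⟩)⟩
      · obtain ⟨c, hc⟩ := h2.back c'
        exact ⟨Sum.inr c, hext a a' _ _ (h1.mono m.le_succ) hc
          (fun i => (h i).imp_right (hlift Sum.inr Sum.inr b b' c c' i))
          (.inr ⟨Fin.last q, by simp, by simp⟩)⟩
  exact equivUpTo_iff_tupleEquiv.2 key

end Operations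

/-! ### The operations on embeddings and components of elements -/

section Components

variable {L : FirstOrder.Language.{u, v}}

/-- A binary operation on structures whose elements are determined by their components in the two
arguments, and which is functorial on embeddings. An element of a product has two components,
an element of a disjoint union has exactly one, whence the components are values in `Option`. -/
structure ComponentOp
    (op : Bundled.{w} L.Structure → Bundled.{w} L.Structure → Bundled.{w} L.Structure) where
  /-- The component of an element in the first argument. -/
  left : ∀ {A B : Bundled.{w} L.Structure}, op A B → Option A
  /-- The component of an element in the second argument. -/
  right : ∀ {A B : Bundled.{w} L.Structure}, op A B → Option B
  ext : ∀ {A B : Bundled.{w} L.Structure} {x y : op A B},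
    left x = left y → right x = right y → x = y
  /-- The embedding of `op A B` into `op A' B'` induced by embeddings of the arguments. -/
  map : ∀ {A B A' B' : Bundled.{w} L.Structure}, (A ↪[L] A') → (B ↪[L] B') →
    (op A B ↪[L] op A' B')
  left_map : ∀ {A B A' B' : Bundled.{w} L.Structure} (f : A ↪[L] A') (g : B ↪[L] B') (x : op A B),
    left (map f g x) = (left x).map f
  right_map : ∀ {A B A' B' : Bundled.{w} L.Structure} (f : A ↪[L] A') (g : B ↪[L] B')
    (x : op A B), right (map f g x) = (right x).map g
  exists_map_eq : ∀ {A B A' B' : Bundled.{w} L.Structure} (f : A ↪[L] A') (g : B ↪[L] B')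
    (y : op A' B'), (∀ a ∈ left y, a ∈ Set.range f) → (∀ b ∈ right y, b ∈ Set.range g) →
      ∃ x, map f g x = y

/-- The components in a product with componentwise functions. -/
def componentOpBooleanProduct (F : ProductRule) :
    ComponentOp (L := L) (booleanProduct.{u, v, w} F) where
  left x := some x.1
  right x := some x.2
  ext h h' := Prod.ext (Option.some_injective _ h) (Option.some_injective _ h')
  map {A B A' B'} f g :=
    { toFun := fun x => (f x.1, g x.2)
      inj' := fun x y h => Prod.ext (f.injective (congrArg Prod.fst h))
        (g.injective (congrArg Prod.snd h))
      map_fun' := fun {n} h x => Prod.ext (f.map_fun h (Prod.fst ∘ x)) (g.map_fun h (Prod.snd ∘ x))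
      map_rel' := fun {n} R x => by
        refine iff_of_eq ?_
        change F n _ _ _ _ = F n _ _ _ _
        congr 1
        · funext i j; exact propext f.injective.eq_iff
        · exact propext (f.map_rel R (Prod.fst ∘ x))
        · funext i j; exact propext g.injective.eq_iff
        · exact propext (g.map_rel R (Prod.snd ∘ x)) }
  left_map _ _ _ := rfl
  right_map _ _ _ := rfl
  exists_map_eq f g y h h' := by
    obtain ⟨a, ha⟩ := h y.1 rfl
    obtain ⟨b, hb⟩ := h' y.2 rfl
    exact ⟨(a, b), Prod.ext ha hb⟩

/-- For an injection `i` of one part into a disjoint union (`i'` likewise in the target), a map `h`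
that extends `f` on this part and sends only this part into the target part preserves and reflects
the statement that a tuple comes from the part and satisfies the predicate there. -/
theorem exists_comp_eq_iff {ι X X' Y Y' : Type*} {i : X → Y} {i' : X' → Y'} {f : X → X'}
    {h : Y → Y'} (hi' : Function.Injective i') (hf : ∀ x, h (i x) = i' (f x))
    (hi : ∀ y x', h y = i' x' → ∃ x, y = i x) {P : (ι → X) → Prop} {P' : (ι → X') → Prop}
    (hP : ∀ a, P' (f ∘ a) ↔ P a) (y : ι → Y) :
    (∃ a', h ∘ y = i' ∘ a' ∧ P' a') ↔ ∃ a, y = i ∘ a ∧ P a := by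
  constructor
  · rintro ⟨a', e, hp⟩
    choose a ha using fun s => hi (y s) (a' s) (congrFun e s)
    obtain rfl : a' = f ∘ a := funext fun s => hi' <| by
      rw [← Function.comp_apply (f := i') (g := a'), ← e, Function.comp_apply, ha s, hf]; rfl
    exact ⟨a, funext ha, (hP a).1 hp⟩
  · rintro ⟨a, rfl, hp⟩
    exact ⟨f ∘ a, funext fun s => hf (a s), (hP a).2 hp⟩

/-- The components in a disjoint union. -/
def componentOpDisjointUnion [L.IsRelational] :
    ComponentOp (L := L) disjointUnion.{u, v, w} where
  left {A B} (x : A ⊕ B) := x.getLeft?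
  right {A B} (x : A ⊕ B) := x.getRight?
  ext {A B} x y h h' := by
    rcases x with x | x <;> rcases y with y | y
    · exact congrArg Sum.inl (Option.some_injective _ h)
    · exact (Option.some_ne_none _ h).elim
    · exact (Option.some_ne_none _ h.symm).elim
    · exact congrArg Sum.inr (Option.some_injective _ h')
  map {A B A' B'} f g :=
    { toFun := (Sum.map f g : A ⊕ B → A' ⊕ B')
      inj' := Sum.map_injective.2 ⟨f.injective, g.injective⟩
      map_fun' := fun {n} h x => isEmptyElim h
      map_rel' := fun {n} R x => by
        refine or_congr
          (exists_comp_eq_iff (Y := A ⊕ B) (Y' := A' ⊕ B') (f := f) (h := Sum.map f g)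
            Sum.inl_injective (fun _ => rfl) ?_ (fun a => f.map_rel R a) x)
          (exists_comp_eq_iff (Y := A ⊕ B) (Y' := A' ⊕ B') (f := g) (h := Sum.map f g)
            Sum.inr_injective (fun _ => rfl) ?_ (fun b => g.map_rel R b) x)
        · rintro (a | b) c h
          exacts [⟨a, rfl⟩, (Sum.inr_ne_inl h).elim]
        · rintro (a | b) c h
          exacts [(Sum.inl_ne_inr h).elim, ⟨b, rfl⟩] }
  left_map {A B A' B'} f g x := by rcases x with x | x <;> rfl
  right_map {A B A' B'} f g x := by rcases x with x | x <;> rfl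
  exists_map_eq {A B A' B'} f g y h h' := by
    rcases y with y | y
    · obtain ⟨a, ha⟩ := h y rfl
      exact ⟨Sum.inl a, congrArg Sum.inl ha⟩
    · obtain ⟨b, hb⟩ := h' y rfl
      exact ⟨Sum.inr b, congrArg Sum.inr hb⟩

/-- The embedding of complements given by an embedding. -/
def complementMap {A B : Bundled.{w} L.Structure} (f : A ↪[L] B) :
    complement A ↪[L] complement B where
  toFun := f
  inj' := f.injective
  map_fun' h x := f.map_fun h x
  map_rel' R x := not_congr (f.map_rel R x)

end Components

/-! ### Well-quasi-ordering -/

section Wqo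

variable {L : FirstOrder.Language.{u, v}} {k : ℕ}

/-- The element of `M` named by the `c`-th new constant. -/
def constantValue (M : Bundled.{w} (L[[Fin k]]).Structure) (c : Fin k) : reductOfConstants k M :=
  M.str.funMap (L.con c : (L[[Fin k]]).Constants) default

/-- The expansion of `A` in which the new constants name the entries of `p`. -/
def expandByConstants (A : Bundled.{w} L.Structure) (p : Fin k → A) :
    Bundled.{w} (L[[Fin k]]).Structure where
  α := A
  str :=
    letI := constantsOn.structure p
    inferInstanceAs ((L.sum (constantsOn (Fin k))).Structure A)

/-- An embedding over the vocabulary with new constants is an embedding of the reducts that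
preserves the values of the new constants. -/
theorem embeds_iff {M N : Bundled.{w} (L[[Fin k]]).Structure} :
    Embeds M N ↔ ∃ f : reductOfConstants k M ↪[L] reductOfConstants k N,
      ∀ c, f (constantValue M c) = constantValue N c := by
  constructor
  · rintro ⟨f⟩
    refine ⟨⟨f.toEmbedding, fun h x => f.map_fun' ((L.lhomWithConstants (Fin k)).onFunction h) x,
      fun r x => f.map_rel' ((L.lhomWithConstants (Fin k)).onRelation r) x⟩, fun c => ?_⟩
    refine (f.map_fun' (L.con c : (L[[Fin k]]).Constants) default).trans ?_
    exact congrArg (N.str.funMap _) (Subsingleton.elim _ _)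
  · rintro ⟨f, hf⟩
    refine ⟨⟨f.toEmbedding, ?_, ?_⟩⟩
    · rintro n (h | h) x
      · exact f.map_fun h x
      · match n, h with
        | 0, c =>
          have hx : x = default := Subsingleton.elim _ _
          subst hx
          refine (hf c).trans ?_
          exact congrArg (N.str.funMap _) (Subsingleton.elim _ _)
        | n + 1, h => exact isEmptyElim (α := (constantsOn (Fin k)).Functions (n + 1)) h
    · rintro n (r | r) x
      · exact f.map_rel r x
      · exact r.elim

/-- Structures of `S` with a partial `k`-tuple of elements. -/
abbrev PartiallyPointed (S : StructClass.{u, v, w} L) (k : ℕ) :=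
  Σ A : {A : Bundled.{w} L.Structure // A ∈ S}, Fin k → Option A.1

/-- Embeddability of structures with partial tuples: the tuples have the same domain, and the
embedding maps one to the other. -/
def PointedEmbeds {S : StructClass.{u, v, w} L} (x y : PartiallyPointed S k) : Prop :=
  ∃ f : x.1.1 ↪[L] y.1.1, ∀ c, y.2 c = (x.2 c).map f

instance {S : StructClass.{u, v, w} L} :
    IsPreorder (PartiallyPointed S k) PointedEmbeds where
  refl x := ⟨Embedding.refl L _, fun c => by
    cases h : x.2 c <;> simp⟩
  trans := fun x y z ⟨f, hf⟩ ⟨g, hg⟩ => ⟨g.comp f, fun c => by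
    rw [hg, hf, Option.map_map]; rfl⟩

/-- Well-quasi-ordering of the expansions by `k` constants extends to partial tuples. The entries
outside the domain can be chosen arbitrarily, unless the structure is empty. An empty structure
has no expansion by constants at all, but it is determined by the truth values of the finitely
many predicates of arity `0`. -/
theorem Pwqo.wellQuasiOrdered_pointedEmbeds (hL : IsFiniteRelational L)
    {S : StructClass.{u, v, w} L} (h : Pwqo S k) :
    WellQuasiOrdered (PointedEmbeds : PartiallyPointed S k → PartiallyPointed S k → Prop) := by
  have := hL.finite_symbols
  have hfin : Finite (L.Relations 0) :=
    Finite.of_injective (fun R => (Sum.inr ⟨0, R⟩ : L.Symbols)) fun R R' e => by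
      simpa using e
  intro M
  let color : ℕ → (Fin k → Bool) × Prop × (L.Relations 0 → Prop) := fun i =>
    (fun c => ((M i).2 c).isSome, Nonempty (M i).1.1,
      fun R => Structure.RelMap (M := (M i).1.1) R default)
  obtain ⟨g, hg⟩ := (Finite.wellQuasiOrdered (α := (Fin k → Bool) × Prop × (L.Relations 0 → Prop))
    (· = ·)).exists_monotone_subseq color
  have hcolor : ∀ i j, color (g i) = color (g j) := fun i j => by
    rcases le_total i j with hij | hij
    exacts [hg i j hij, (hg j i hij).symm]
  have hdom : ∀ i j c, ((M (g i)).2 c).isSome = ((M (g j)).2 c).isSome := fun i j c =>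
    congrFun (congrArg Prod.fst (hcolor i j)) c
  by_cases hne : Nonempty (M (g 0)).1.1
  · have hne' : ∀ i, Nonempty (M (g i)).1.1 := fun i =>
      (congrArg (fun x => x.2.1) (hcolor 0 i)).mp hne
    let p : ∀ i, Fin k → (M (g i)).1.1 := fun i c => ((M (g i)).2 c).getD (hne' i).some
    obtain ⟨i, j, hij, hemb⟩ := h (fun i => expandByConstants (M (g i)).1.1 (p i))
      (fun i => (M (g i)).1.2)
    obtain ⟨f, hf⟩ := embeds_iff.1 hemb
    refine ⟨g i, g j, g.strictMono hij, f, fun c => ?_⟩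
    have hfc : f (p i c) = p j c := hf c
    have hd := hdom i j c
    simp only [p] at hfc
    cases hi : (M (g i)).2 c with
    | none => cases hj : (M (g j)).2 c with
      | none => rfl
      | some b => simp [hi, hj] at hd
    | some a => cases hj : (M (g j)).2 c with
      | none => simp [hi, hj] at hd
      | some b =>
        rw [hi, hj] at hfc
        exact congrArg some hfc.symm
  · have hempty : ∀ i, IsEmpty (M (g i)).1.1 := fun i => by
      refine not_nonempty_iff.1 fun hi => hne ?_
      exact (congrArg (fun x => x.2.1) (hcolor i 0)).mp hi
    have h0 := hempty 0
    have h1 := hempty 1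
    refine ⟨g 0, g 1, g.strictMono Nat.zero_lt_one,
      ⟨⟨isEmptyElim, fun a => isEmptyElim a⟩, ?_, ?_⟩, fun c => ?_⟩
    · intro n f x
      exact isEmptyElim (Structure.funMap f x)
    · intro n R x
      cases n with
      | zero =>
        have e := congrFun (congrArg (fun x => x.2.2) (hcolor 1 0)) R
        exact iff_of_eq ((congrArg (Structure.RelMap R) (Subsingleton.elim _ default)).trans
          (e.trans (congrArg (Structure.RelMap R) (Subsingleton.elim default x))))
      | succ n => exact isEmptyElim (x 0)
    · cases (M (g 0)).2 c with
      | none => cases (M (g 1)).2 c with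
        | none => rfl
        | some b => exact isEmptyElim b
      | some a => exact isEmptyElim a

theorem Pwqo.compl {S : StructClass.{u, v, w} L} (h : Pwqo S k) : Pwqo S.compl k := by
  intro M hM
  choose A hA e using hM
  replace e := fun i => (e i).some
  obtain ⟨i, j, hij, hemb⟩ := h
    (fun i => expandByConstants (A i) fun c => (e i).symm (constantValue (M i) c)) hA
  obtain ⟨f, hf⟩ := embeds_iff.1 hemb
  have hf : ∀ c, f ((e i).symm (constantValue (M i) c)) = (e j).symm (constantValue (M j) c) := hf
  refine ⟨i, j, hij, embeds_iff.2 ⟨((e j).toEmbedding.comp (complementMap f)).comp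
    (e i).symm.toEmbedding, fun c => ?_⟩⟩
  refine (congrArg (e j) (hf c)).trans ?_
  exact (e j).apply_symm_apply _

theorem Pwqo.binary (hL : IsFiniteRelational L)
    {op : Bundled.{w} L.Structure → Bundled.{w} L.Structure → Bundled.{w} L.Structure}
    (C : ComponentOp op)
    {hop : ∀ A B : Bundled.{w} L.Structure, Finite A → Finite B → Finite (op A B)}
    {S₁ S₂ : StructClass.{u, v, w} L} (h₁ : Pwqo S₁ k) (h₂ : Pwqo S₂ k) :
    Pwqo (StructClass.binary op hop S₁ S₂) k := by
  intro M hM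
  choose A hA B hB e using hM
  replace e := fun i => (e i).some
  obtain ⟨i, j, hij, ⟨f, hf⟩, ⟨g, hg⟩⟩ :=
    ((h₁.wellQuasiOrdered_pointedEmbeds hL).prod (h₂.wellQuasiOrdered_pointedEmbeds hL))
      (fun i => (⟨⟨A i, hA i⟩, fun c => C.left ((e i).symm (constantValue (M i) c))⟩,
        ⟨⟨B i, hB i⟩, fun c => C.right ((e i).symm (constantValue (M i) c))⟩))
  refine ⟨i, j, hij, embeds_iff.2 ⟨((e j).toEmbedding.comp (C.map f g)).comp
    (e i).symm.toEmbedding, fun c => ?_⟩⟩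
  have key : C.map f g ((e i).symm (constantValue (M i) c)) =
      (e j).symm (constantValue (M j) c) :=
    C.ext ((C.left_map f g _).trans (hf c).symm) ((C.right_map f g _).trans (hg c).symm)
  refine (congrArg (e j) key).trans ?_
  exact (e j).apply_symm_apply _

end Wqo

/-! ### Small equivalent substructures -/

section Plogic

variable {L : FirstOrder.Language.{u, v}} {k : ℕ}

theorem EquivUpTo.of_equiv {M N : Type w} [L.Structure M] [L.Structure N] (e : M ≃[L] N) (m : ℕ) :
    EquivUpTo (L := L) m M N :=
  fun φ _ => StrongHomClass.realize_sentence e φ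

theorem EquivUpTo.trans {M N P : Type w} [L.Structure M] [L.Structure N] [L.Structure P] {m : ℕ}
    (h : EquivUpTo (L := L) m M N) (h' : EquivUpTo (L := L) m N P) :
    EquivUpTo (L := L) m M P :=
  fun φ hφ => (h φ hφ).trans (h' φ hφ)

/-- A witness for `A` may be given as a structure `B` embedded in an isomorphic copy of `A`
instead of as a substructure of `A`. -/
theorem exists_substructure_of_embedding {S : StructClass.{u, v, w} L}
    {A A' B : Bundled.{w} L.Structure} {m r : ℕ} (e : A' ≃[L] A) (f : B ↪[L] A') (hB : B ∈ S)
    {W : Finset A} (hW : ∀ x ∈ W, e.symm x ∈ Set.range f) (hcard : Nat.card B ≤ r)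
    (hm : EquivUpTo (L := L) m B A') :
    ∃ D : L.Substructure A, (Bundled.of D : Bundled.{w} L.Structure) ∈ S ∧
      (W : Set A) ⊆ D ∧ Nat.card D ≤ r ∧ EquivUpTo (L := L) m D A := by
  let g : B ↪[L] A := e.toEmbedding.comp f
  refine ⟨g.toHom.range, S.iso_closed B hB _ ⟨g.equivRange⟩, ?_, ?_, ?_⟩
  · intro x hx
    obtain ⟨b, hb⟩ := hW x hx
    exact ⟨b, (congrArg e hb).trans (e.apply_symm_apply x)⟩
  · exact (Nat.card_congr g.equivRange.toEquiv).symm.trans_le hcard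
  · exact (EquivUpTo.of_equiv g.equivRange.symm m).trans (hm.trans (EquivUpTo.of_equiv e m))

theorem IsPlogicWitness.compl {S : StructClass.{u, v, w} L} {α : ℕ → ℕ}
    (h : IsPlogicWitness S k α) : IsPlogicWitness S.compl k α := by
  classical
  rintro m A ⟨A₁, hA₁, ⟨e⟩⟩ W hW
  obtain ⟨B, hB, hWB, hcard, hm⟩ := h m A₁ hA₁ (W.image e.symm)
    (Finset.card_image_le.trans hW)
  have := S.finite _ hA₁
  have := S.finite _ hB
  refine exists_substructure_of_embedding (S := S.compl) e
    (complementMap (A := Bundled.of B) (B := A₁) B.subtype)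
    ⟨Bundled.of B, hB, ⟨Language.Equiv.refl L _⟩⟩ ?_ hcard
    (equivUpTo_complement (A := Bundled.of B) (A' := A₁) hm)
  intro x hx
  exact ⟨⟨e.symm x, hWB (Finset.mem_coe.2 (Finset.mem_image_of_mem _ hx))⟩, rfl⟩

theorem IsPlogicWitness.binary
    {op : Bundled.{w} L.Structure → Bundled.{w} L.Structure → Bundled.{w} L.Structure}
    (C : ComponentOp op)
    {hop : ∀ A B : Bundled.{w} L.Structure, Finite A → Finite B → Finite (op A B)}
    (hequiv : ∀ {A A' B B' : Bundled.{w} L.Structure} {m : ℕ}, Finite A → Finite A' → Finite B →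
      Finite B' → EquivUpTo (L := L) m A A' → EquivUpTo (L := L) m B B' →
        EquivUpTo (L := L) m (op A B) (op A' B'))
    {S₁ S₂ : StructClass.{u, v, w} L} {α₁ α₂ β : ℕ → ℕ}
    (hβ : ∀ {A B : Bundled.{w} L.Structure} {m : ℕ}, Finite A → Finite B → Nat.card A ≤ α₁ m →
      Nat.card B ≤ α₂ m → Nat.card (op A B) ≤ β m)
    (h₁ : IsPlogicWitness S₁ k α₁) (h₂ : IsPlogicWitness S₂ k α₂) :
    IsPlogicWitness (StructClass.binary op hop S₁ S₂) k β := by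
  classical
  rintro m A ⟨A₁, hA₁, A₂, hA₂, ⟨e⟩⟩ W hW
  obtain ⟨B₁, hB₁, hWB₁, hcard₁, hm₁⟩ := h₁ m A₁ hA₁
    (W.image fun x => C.left (e.symm x)).eraseNone
    ((Finset.card_eraseNone_le _).trans (Finset.card_image_le.trans hW))
  obtain ⟨B₂, hB₂, hWB₂, hcard₂, hm₂⟩ := h₂ m A₂ hA₂
    (W.image fun x => C.right (e.symm x)).eraseNone
    ((Finset.card_eraseNone_le _).trans (Finset.card_image_le.trans hW))
  have f₁ := S₁.finite _ hA₁
  have f₂ := S₂.finite _ hA₂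
  have g₁ := S₁.finite _ hB₁
  have g₂ := S₂.finite _ hB₂
  refine exists_substructure_of_embedding (S := StructClass.binary op hop S₁ S₂) e
    (C.map (A := Bundled.of B₁) (A' := A₁) (B := Bundled.of B₂) (B' := A₂) B₁.subtype B₂.subtype)
    ⟨Bundled.of B₁, hB₁, Bundled.of B₂, hB₂, ⟨Language.Equiv.refl L _⟩⟩ ?_
    (hβ g₁ g₂ hcard₁ hcard₂) (hequiv g₁ f₁ g₂ f₂ hm₁ hm₂)
  intro x hx
  refine C.exists_map_eq _ _ _ (fun a ha => ?_) (fun b hb => ?_)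
  · exact ⟨⟨a, hWB₁ (Finset.mem_coe.2 (Finset.mem_eraseNone.2
      (Finset.mem_image.2 ⟨x, hx, ha⟩)))⟩, rfl⟩
  · exact ⟨⟨b, hWB₂ (Finset.mem_coe.2 (Finset.mem_eraseNone.2
      (Finset.mem_image.2 ⟨x, hx, hb⟩)))⟩, rfl⟩

theorem IsPlogicCompWitness.compl {S : StructClass.{u, v, w} L} {α : ℕ → ℕ}
    (h : IsPlogicCompWitness S k α) : IsPlogicCompWitness S.compl k α :=
  ⟨h.1, h.2.compl⟩

variable {S₁ S₂ : StructClass.{u, v, w} L} {α₁ α₂ : ℕ → ℕ}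

theorem IsPlogicCompWitness.disjUnion [L.IsRelational] (h₁ : IsPlogicCompWitness S₁ k α₁)
    (h₂ : IsPlogicCompWitness S₂ k α₂) :
    IsPlogicCompWitness (S₁.disjUnion S₂) k (fun m => α₁ m + α₂ m) := by
  refine ⟨Primrec.nat_add.to_comp.comp h₁.1 h₂.1, h₁.2.binary componentOpDisjointUnion
    (fun _ _ _ _ => equivUpTo_disjointUnion) ?_ h₂.2⟩
  intro A B m _ _ hA hB
  exact (Nat.card_sum (α := A) (β := B)).trans_le (add_le_add hA hB)

theorem isPlogicCompWitness_booleanProduct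
    (F : ProductRule)
    {hop : ∀ A B : Bundled.{w} L.Structure, Finite A → Finite B → Finite (booleanProduct F A B)}
    (h₁ : IsPlogicCompWitness S₁ k α₁) (h₂ : IsPlogicCompWitness S₂ k α₂) :
    IsPlogicCompWitness (StructClass.binary (booleanProduct F) hop S₁ S₂) k
      (fun m => α₁ m * α₂ m) := by
  refine ⟨Primrec.nat_mul.to_comp.comp h₁.1 h₂.1, h₁.2.binary (componentOpBooleanProduct F)
    (fun _ _ _ _ => equivUpTo_booleanProduct F) ?_ h₂.2⟩
  intro A B m _ _ hA hB
  exact (Nat.card_prod A B).trans_le (Nat.mul_le_mul hA hB)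

theorem IsPlogicCompWitness.cartesian (h₁ : IsPlogicCompWitness S₁ k α₁)
    (h₂ : IsPlogicCompWitness S₂ k α₂) :
    IsPlogicCompWitness (S₁.cartesian S₂) k (fun m => α₁ m * α₂ m) :=
  isPlogicCompWitness_booleanProduct cartesianRule h₁ h₂

theorem IsPlogicCompWitness.tensor (h₁ : IsPlogicCompWitness S₁ k α₁)
    (h₂ : IsPlogicCompWitness S₂ k α₂) :
    IsPlogicCompWitness (S₁.tensor S₂) k (fun m => α₁ m * α₂ m) :=
  isPlogicCompWitness_booleanProduct tensorRule h₁ h₂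

end Plogic

end StructClasses

theorem mainTheorem6 {L : FirstOrder.Language.{u, v}} (hL : StructClasses.IsFiniteRelational L)
    (k : ℕ) (S₁ S₂ : StructClasses.StructClass.{u, v, w} L) :
    -- preservation of `P_wqo`
    (StructClasses.Pwqo S₁ k → StructClasses.Pwqo S₁.compl k) ∧
    (StructClasses.Pwqo S₁ k → StructClasses.Pwqo S₂ k →
      (∀ _ : L.IsRelational, StructClasses.Pwqo (S₁.disjUnion S₂) k) ∧
      StructClasses.Pwqo (S₁.cartesian S₂) k ∧
      StructClasses.Pwqo (S₁.tensor S₂) k) ∧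
    -- preservation of `P_logic^comp`
    (StructClasses.PlogicComp S₁ k → StructClasses.PlogicComp S₁.compl k) ∧
    (StructClasses.PlogicComp S₁ k → StructClasses.PlogicComp S₂ k →
      (∀ _ : L.IsRelational, StructClasses.PlogicComp (S₁.disjUnion S₂) k) ∧
      StructClasses.PlogicComp (S₁.cartesian S₂) k ∧
      StructClasses.PlogicComp (S₁.tensor S₂) k) ∧
    -- the witness functions
    (∀ α₁ : ℕ → ℕ, StructClasses.IsPlogicCompWitness S₁ k α₁ →
      StructClasses.IsPlogicCompWitness S₁.compl k α₁) ∧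
    (∀ α₁ α₂ : ℕ → ℕ, StructClasses.IsPlogicCompWitness S₁ k α₁ →
      StructClasses.IsPlogicCompWitness S₂ k α₂ →
      (∀ _ : L.IsRelational,
        StructClasses.IsPlogicCompWitness (S₁.disjUnion S₂) k (fun m => α₁ m + α₂ m)) ∧
      StructClasses.IsPlogicCompWitness (S₁.cartesian S₂) k (fun m => α₁ m * α₂ m) ∧
      StructClasses.IsPlogicCompWitness (S₁.tensor S₂) k (fun m => α₁ m * α₂ m)) := by
  refine ⟨fun h => h.compl, fun h₁ h₂ => ⟨fun _ => ?_, ?_, ?_⟩, ?_, ?_, fun _ h => h.compl,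
    fun _ _ h₁ h₂ => ⟨fun _ => h₁.disjUnion h₂, h₁.cartesian h₂, h₁.tensor h₂⟩⟩
  · exact h₁.binary hL StructClasses.componentOpDisjointUnion h₂
  · exact h₁.binary hL (StructClasses.componentOpBooleanProduct StructClasses.cartesianRule) h₂
  · exact h₁.binary hL (StructClasses.componentOpBooleanProduct StructClasses.tensorRule) h₂
  · rintro ⟨α, h⟩
    exact ⟨α, h.compl⟩
  · rintro ⟨α₁, h₁⟩ ⟨α₂, h₂⟩
    exact ⟨fun _ => ⟨_, h₁.disjUnion h₂⟩, ⟨_, h₁.cartesian h₂⟩, ⟨_, h₁.tensor h₂⟩⟩
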